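/- Let $n\ge 1$ and let $p=\mathrm{normal}(\boldsymbol\mu,\boldsymbol\Sigma)$ be a Gaussian distribution on $\mathbb{R}^n$ whose covariance matrix $\boldsymbol\Sigma$ is positive definite but not diagonal. Let $\mathcal{Q}$ be the family of Gaussian distributions $\mathrm{normal}(\boldsymbol\nu,\boldsymbol\Psi)$ on $\mathbb{R}^n$ with $\boldsymbol\Psi$ diagonal and positive definite. For $\alpha\in(0,1)$ and $q\in\mathcal{Q}$, identify $p$ and $q$ with their Lebesgue densities and let $$R_\alpha(p\|q)=\frac{1}{\alpha(\alpha-1)}\int_{\mathbb{R}^n}\left(\frac{p(\mathbf z)^\alpha}{q(\mathbf z)^\alpha}-1\right)q(\mathbf z)\,d\mathbf z .$$ Write $\mathcal{H}(q)=-\int q(\mathbf z)\log q(\mathbf z)\,d\mathbf z$ for the entropy, and call the determinant of the covariance matrix the generalized variance. Then: 1. for every $\alpha\in(0,1)$ there is a unique minimizer $q_\alpha$ of $R_\alpha(p\|q)$ over $q\in\mathcal{Q}$; 2. there is a unique $\alpha\in(0,1)$ such that $\mathcal{H}(q_\alpha)=\mathcal{H}(p)$; 3. for every $q\in\mathcal{Q}$,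 $\mathcal{H}(q)=\mathcal{H}(p)$ if and only if $q$ and $p$ have the same generalized variance; thus the $\alpha$ in part 2 is also the unique $\alpha\in(0,1)$ for which $q_\alpha$ has the same generalized variance as $p$. -/

import Mathlib

open MeasureTheory ProbabilityTheory Set

namespace FactorizedVI

/-- The density of a measure on `ℝⁿ` with respect to Lebesgue measure. -/
noncomputable def density {n : ℕ} (p : Measure (EuclideanSpace ℝ (Fin n)))
    (z : EuclideanSpace ℝ (Fin n)) : ℝ :=
  (p.rnDeriv volume z).toReal

/-- The Rényi divergence (α-divergence) of order `α`,
`R_α(p‖q) = 1 / (α (α - 1)) * ∫ (p(z)^α / q(z)^α - 1) q(z) dz`,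
for `p` and `q` with Lebesgue densities. -/
noncomputable def renyiDiv {n : ℕ} (α : ℝ) (p q : Measure (EuclideanSpace ℝ (Fin n))) : ℝ :=
  1 / (α * (α - 1)) *
    ∫ z, (density p z ^ α / density q z ^ α - 1) * density q z

/-- The differential entropy `-∫ p(z) log p(z) dz`. -/
noncomputable def entropy {n : ℕ} (p : Measure (EuclideanSpace ℝ (Fin n))) : ℝ :=
  -∫ z, density p z * Real.log (density p z)

/-- The covariance matrix of a measure on `ℝⁿ`. -/
noncomputable def covMatrix {n : ℕ} (p : Measure (EuclideanSpace ℝ (Fin n))) :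
    Matrix (Fin n) (Fin n) ℝ :=
  Matrix.of fun i j => cov[fun z => z i, fun z => z j; p]

/-- The generalized variance: the determinant of the covariance matrix. -/
noncomputable def generalizedVariance {n : ℕ} (p : Measure (EuclideanSpace ℝ (Fin n))) : ℝ :=
  (covMatrix p).det

/-- The variational family of nondegenerate Gaussians with diagonal covariance. -/
def factorizedGaussians (n : ℕ) : Set (Measure (EuclideanSpace ℝ (Fin n))) :=
  {q | ∃ (ν : EuclideanSpace ℝ (Fin n)) (Ψ : Matrix (Fin n) (Fin n) ℝ),
    Ψ.PosDef ∧ Ψ.IsDiag ∧ q = multivariateGaussian ν Ψ}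

/-- `q` is a factorized Gaussian that minimizes `R_α(p‖·)` over all factorized Gaussians. -/
def IsRenyiMinimizer {n : ℕ} (α : ℝ) (p q : Measure (EuclideanSpace ℝ (Fin n))) : Prop :=
  q ∈ factorizedGaussians n ∧ IsMinOn (fun q' => renyiDiv α p q') (factorizedGaussians n) q

end FactorizedVI

/-!
The divergence from `p = normal(μ, S)` to `q = normal(ν, Ψ)` is an increasing function of the
Chernoff exponent `-log ∫ p ^ α q ^ (1 - α)`, which completing the square evaluates to half of

  `log det (α Ψ + (1 - α) S) - α log det Ψ - (1 - α) log det S`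

plus a positive definite quadratic form in `ν - μ`. So the minimizer has mean `μ`, and its
variances `d` minimize the Jensen gap above. In the coordinates `log d` the first term is convex,
so the stationary points are strict minimizers; stationarity says that `d i` is the reciprocal of
the `i`-th diagonal entry of `(α diag d + (1 - α) S)⁻¹`. The right-hand side of this fixed-point
equation is monotone in `d`, which gives existence, and a comparison of two solutions shows that
the solution is unique and strictly increasing in `α`.

By Hadamard's inequality for `S⁻¹` and for `S`, the product of the `d i` lies below `det S` at
`α = 0`, where `d i` is the reciprocal of the `i`-th diagonal entry of `S⁻¹`, and above it in the
limit `α → 1`, where `d i` tends to the `i`-th diagonal entry of `S`. Continuity and monotonicity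
leave exactly one order at which the determinants, hence the entropies, agree.
-/

namespace FactorizedVI

open Matrix

section QuadraticForms

theorem isSymm_of_posDef {ι : Type*} {A : Matrix ι ι ℝ} (hA : A.PosDef) : A.IsSymm := by
  simpa [IsSymm] using hA.isHermitian.eq

theorem posDef_smul_add_smul {ι : Type*} {A B : Matrix ι ι ℝ} (hA : A.PosDef) (hB : B.PosDef)
    {a b : ℝ} (ha : 0 ≤ a) (hb : 0 ≤ b) (hab : a + b = 1) : (a • A + b • B).PosDef := by
  rcases ha.eq_or_lt with rfl | ha
  · rw [zero_add] at hab
    rwa [zero_smul, zero_add, hab, one_smul]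
  · exact (hA.smul ha).add_posSemidef (hB.posSemidef.smul hb)

variable {ι : Type*} [Fintype ι] [DecidableEq ι]

theorem dotProduct_mulVec_add_inv_mulVec {R : Type*} [CommRing R] {A : Matrix ι ι R}
    (hA : A.IsSymm) (hdet : IsUnit A.det) (x y : ι → R) :
    (x + A⁻¹ *ᵥ y) ⬝ᵥ A *ᵥ (x + A⁻¹ *ᵥ y) = x ⬝ᵥ A *ᵥ x + 2 * (x ⬝ᵥ y) + y ⬝ᵥ A⁻¹ *ᵥ y := by
  have hcancel : A *ᵥ A⁻¹ *ᵥ y = y := by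
    rw [mulVec_mulVec, mul_nonsing_inv _ hdet, one_mulVec]
  have hcross : (A⁻¹ *ᵥ y) ⬝ᵥ A *ᵥ x = x ⬝ᵥ y := by
    rw [dotProduct_mulVec, ← mulVec_transpose, hA.eq, hcancel, dotProduct_comm]
  rw [mulVec_add, add_dotProduct, dotProduct_add, dotProduct_add, hcancel, hcross,
    dotProduct_comm (A⁻¹ *ᵥ y) y]
  ring

variable {A B : Matrix ι ι ℝ}

theorem two_mul_dotProduct_sub_lt (hA : A.PosDef) {x v : ι → ℝ} (hx : x ≠ A⁻¹ *ᵥ v) :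
    2 * (x ⬝ᵥ v) - x ⬝ᵥ A *ᵥ x < v ⬝ᵥ A⁻¹ *ᵥ v := by
  have hpos := hA.dotProduct_mulVec_pos (sub_ne_zero.2 hx)
  rw [star_trivial, sub_eq_add_neg, ← mulVec_neg, dotProduct_mulVec_add_inv_mulVec
    (isSymm_of_posDef hA) hA.det_pos.ne'.isUnit, mulVec_neg, dotProduct_neg, neg_dotProduct_neg]
    at hpos
  linarith

theorem dotProduct_inv_mulVec_eq_sub (hA : A.PosDef) (v : ι → ℝ) :
    v ⬝ᵥ A⁻¹ *ᵥ v = 2 * ((A⁻¹ *ᵥ v) ⬝ᵥ v) - (A⁻¹ *ᵥ v) ⬝ᵥ A *ᵥ (A⁻¹ *ᵥ v) := by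
  rw [mulVec_mulVec, mul_nonsing_inv _ hA.det_pos.ne'.isUnit, one_mulVec, dotProduct_comm _ v]
  ring

theorem two_mul_dotProduct_sub_le (hA : A.PosDef) (x v : ι → ℝ) :
    2 * (x ⬝ᵥ v) - x ⬝ᵥ A *ᵥ x ≤ v ⬝ᵥ A⁻¹ *ᵥ v := by
  rcases eq_or_ne x (A⁻¹ *ᵥ v) with rfl | hx
  · exact (dotProduct_inv_mulVec_eq_sub hA v).ge
  · exact (two_mul_dotProduct_sub_lt hA hx).le

theorem dotProduct_inv_mulVec_add_le (hA : A.PosDef) (hB : B.PosDef) (v : ι → ℝ) :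
    v ⬝ᵥ B⁻¹ *ᵥ v + (B⁻¹ *ᵥ v) ⬝ᵥ (B - A) *ᵥ (B⁻¹ *ᵥ v) ≤ v ⬝ᵥ A⁻¹ *ᵥ v := by
  have h := two_mul_dotProduct_sub_le hA (B⁻¹ *ᵥ v) v
  rw [dotProduct_inv_mulVec_eq_sub hB, sub_mulVec, dotProduct_sub]
  linarith

theorem dotProduct_inv_smul_add_smul_mulVec (hA : A.PosDef) (hB : B.PosDef) {a b : ℝ}
    (ha : 0 ≤ a) (hb : 0 ≤ b) (hab : a + b = 1) {v x : ι → ℝ}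
    (hx : x = (a • A + b • B)⁻¹ *ᵥ v) :
    v ⬝ᵥ (a • A + b • B)⁻¹ *ᵥ v =
      a * (2 * (x ⬝ᵥ v) - x ⬝ᵥ A *ᵥ x) + b * (2 * (x ⬝ᵥ v) - x ⬝ᵥ B *ᵥ x) := by
  rw [dotProduct_inv_mulVec_eq_sub (posDef_smul_add_smul hA hB ha hb hab) v, ← hx]
  simp only [add_mulVec, smul_mulVec, dotProduct_add, dotProduct_smul, smul_eq_mul]
  linear_combination -2 * (x ⬝ᵥ v) * hab

theorem dotProduct_inv_smul_add_smul_mulVec_le (hA : A.PosDef) (hB : B.PosDef) {a b : ℝ}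
    (ha : 0 ≤ a) (hb : 0 ≤ b) (hab : a + b = 1) (v : ι → ℝ) :
    v ⬝ᵥ (a • A + b • B)⁻¹ *ᵥ v ≤ a * (v ⬝ᵥ A⁻¹ *ᵥ v) + b * (v ⬝ᵥ B⁻¹ *ᵥ v) := by
  rw [dotProduct_inv_smul_add_smul_mulVec hA hB ha hb hab rfl]
  gcongr <;> exact two_mul_dotProduct_sub_le ‹_› _ v

theorem inv_mulVec_eq_of_dotProduct_eq (hA : A.PosDef) (hB : B.PosDef) {a b : ℝ}
    (ha : 0 < a) (hb : 0 < b) (hab : a + b = 1) {v : ι → ℝ}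
    (h : v ⬝ᵥ (a • A + b • B)⁻¹ *ᵥ v = a * (v ⬝ᵥ A⁻¹ *ᵥ v) + b * (v ⬝ᵥ B⁻¹ *ᵥ v)) :
    A⁻¹ *ᵥ v = B⁻¹ *ᵥ v := by
  obtain ⟨x, hx⟩ : ∃ x, x = (a • A + b • B)⁻¹ *ᵥ v := ⟨_, rfl⟩
  rw [dotProduct_inv_smul_add_smul_mulVec hA hB ha.le hb.le hab hx] at h
  have hleA := mul_le_mul_of_nonneg_left (two_mul_dotProduct_sub_le hA x v) ha.le
  have hleB := mul_le_mul_of_nonneg_left (two_mul_dotProduct_sub_le hB x v) hb.le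
  have hxA : x = A⁻¹ *ᵥ v := by
    by_contra hne
    linarith [mul_lt_mul_of_pos_left (two_mul_dotProduct_sub_lt hA hne) ha]
  have hxB : x = B⁻¹ *ᵥ v := by
    by_contra hne
    linarith [mul_lt_mul_of_pos_left (two_mul_dotProduct_sub_lt hB hne) hb]
  rw [← hxA, hxB]

end QuadraticForms

section InverseDiagonal

variable {ι : Type*} [Fintype ι] [DecidableEq ι]

theorem single_one_dotProduct_mulVec_single_one {R : Type*} [CommSemiring R] (A : Matrix ι ι R)
    (i : ι) : Pi.single i 1 ⬝ᵥ A *ᵥ Pi.single i 1 = A i i := by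
  rw [single_one_dotProduct, mulVec_single_one, col_apply]

variable {A B : Matrix ι ι ℝ}

theorem inv_apply_self_le_of_posSemidef_sub (hA : A.PosDef) (hB : B.PosDef)
    (h : (B - A).PosSemidef) (i : ι) : B⁻¹ i i ≤ A⁻¹ i i := by
  have hform := dotProduct_inv_mulVec_add_le hA hB (Pi.single i 1)
  have hnonneg := h.dotProduct_mulVec_nonneg (B⁻¹ *ᵥ Pi.single i 1)
  rw [star_trivial] at hnonneg
  simpa only [single_one_dotProduct_mulVec_single_one] using (le_add_of_nonneg_right hnonneg).trans
    hform

theorem inv_apply_self_lt_of_posDef_sub (hA : A.PosDef) (h : (B - A).PosDef) (i : ι) :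
    B⁻¹ i i < A⁻¹ i i := by
  have hB : B.PosDef := by simpa using hA.add h
  have hne : B⁻¹ *ᵥ Pi.single i 1 ≠ 0 := fun h0 => by
    have hpos : 0 < B⁻¹ i i := hB.inv.diag_pos
    rw [← single_one_dotProduct_mulVec_single_one B⁻¹, h0, dotProduct_zero] at hpos
    exact hpos.false
  have hform := dotProduct_inv_mulVec_add_le hA hB (Pi.single i 1)
  have hpos := h.dotProduct_mulVec_pos hne
  rw [star_trivial] at hpos
  simpa only [single_one_dotProduct_mulVec_single_one] using (lt_add_of_pos_right _ hpos).trans_le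
    hform

theorem inv_smul_add_smul_apply_self_le (hA : A.PosDef) (hB : B.PosDef) {a b : ℝ}
    (ha : 0 ≤ a) (hb : 0 ≤ b) (hab : a + b = 1) (i : ι) :
    (a • A + b • B)⁻¹ i i ≤ a * A⁻¹ i i + b * B⁻¹ i i := by
  simpa only [single_one_dotProduct_mulVec_single_one] using
    dotProduct_inv_smul_add_smul_mulVec_le hA hB ha hb hab (Pi.single i 1)

theorem eq_of_inv_smul_add_smul_apply_self_eq (hA : A.PosDef) (hB : B.PosDef) {a b : ℝ}
    (ha : 0 < a) (hb : 0 < b) (hab : a + b = 1)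
    (h : ∀ i, (a • A + b • B)⁻¹ i i = a * A⁻¹ i i + b * B⁻¹ i i) : A = B := by
  refine inv_inj (ext_of_mulVec_single fun i => ?_) hA.det_pos.ne'.isUnit
  refine inv_mulVec_eq_of_dotProduct_eq hA hB ha hb hab ?_
  simpa only [single_one_dotProduct_mulVec_single_one] using h i

theorem inv_le_inv_apply_self (hA : A.PosDef) (i : ι) : (A i i)⁻¹ ≤ A⁻¹ i i := by
  have hpos : 0 < A i i := hA.diag_pos
  have h := two_mul_dotProduct_sub_le hA ((A i i)⁻¹ • Pi.single i 1) (Pi.single i 1)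
  rw [mulVec_smul, smul_dotProduct, smul_dotProduct, dotProduct_smul,
    single_one_dotProduct_mulVec_single_one, single_one_dotProduct_mulVec_single_one,
    single_one_dotProduct, Pi.single_eq_same, smul_eq_mul, smul_eq_mul, smul_eq_mul,
    inv_mul_cancel₀ hpos.ne'] at h
  linarith

end InverseDiagonal

section DiagonalPerturbation

variable {ι : Type*} [Fintype ι] [DecidableEq ι] {R : Type*} [CommRing R]

/-- The principal minor of `A` on the complement of `s`: the coefficient of `∏ i ∈ s, d i` in
`det (diagonal d + A)`. -/
def complMinor (A : Matrix ι ι R) (s : Finset ι) : R :=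
  (A.submatrix (Subtype.val : {i // i ∉ s} → ι) Subtype.val).det

theorem complMinor_pos {A : Matrix ι ι ℝ} (hA : A.PosDef) (s : Finset ι) : 0 < complMinor A s :=
  (hA.submatrix Subtype.val_injective).det_pos

theorem det_ite_diagonal (d : ι → R) (A : Matrix ι ι R) (s : Finset ι) :
    (of fun i => if i ∈ s then (diagonal d).row i else A.row i).det =
      (∏ i ∈ s, d i) * complMinor A s := by
  set M := of fun i => if i ∈ s then (diagonal d).row i else A.row i
  have hcompl : toSquareBlockProp M (· ∉ s) = A.submatrix Subtype.val Subtype.val := by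
    ext i j
    simp [M, toSquareBlockProp_def, i.2]
  have hblock : toSquareBlockProp M (fun i => ¬ i ∉ s) =
      diagonal fun i : {i // ¬ i ∉ s} => d i := by
    ext i j
    simp [M, toSquareBlockProp_def, diagonal_apply, not_not.1 i.2, Subtype.ext_iff, Pi.single_apply,
      eq_comm]
  rw [twoBlockTriangular_det M (· ∉ s) fun i hi j hj => ?_, hblock, hcompl, det_diagonal, mul_comm,
    Finset.prod_subtype s fun _ => not_not.symm, complMinor]
  have hi : i ∈ s := not_not.1 hi
  simp [M, hi, (ne_of_mem_of_not_mem hi hj).symm]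

theorem det_diagonal_add (d : ι → R) (A : Matrix ι ι R) :
    (diagonal d + A).det = ∑ s : Finset ι, (∏ i ∈ s, d i) * complMinor A s := by
  simp_rw [← det_ite_diagonal]
  exact (detRowAlternating (n := ι) (R := R)).toMultilinearMap.map_add_univ (diagonal d) A

theorem det_diagonal_update_add (d : ι → R) (A : Matrix ι ι R) (i : ι) (x : R) :
    (diagonal (Function.update d i x) + A).det =
      (diagonal d + A).det + (x - d i) * (diagonal d + A).adjugate i i := by
  have hrow : diagonal (Function.update d i x) + A =
      (diagonal d + A).updateRow i ((diagonal d + A) i + (x - d i) • Pi.single i 1) := by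
    ext j k
    rcases eq_or_ne j i with rfl | hj
    · rcases eq_or_ne j k with rfl | hk
      · simp only [Matrix.add_apply, diagonal_apply_eq, Function.update_self, updateRow_self,
          Pi.add_apply, Pi.smul_apply, Pi.single_eq_same, smul_eq_mul, mul_one]
        ring
      · simp [hk, hk.symm]
    · rcases eq_or_ne j k with rfl | hk <;> simp [*]
  rw [hrow, det_updateRow_add, det_updateRow_smul, updateRow_eq_self, adjugate_apply]

theorem mul_adjugate_diagonal_add_apply_self (d : ι → R) (A : Matrix ι ι R) (i : ι) :
    d i * (diagonal d + A).adjugate i i =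
      ∑ s : Finset ι, if i ∈ s then (∏ j ∈ s, d j) * complMinor A s else 0 := by
  have h := det_diagonal_update_add d A i 0
  rw [det_diagonal_add, det_diagonal_add, zero_sub, neg_mul, eq_add_neg_iff_add_eq, add_comm,
    ← eq_sub_iff_add_eq, ← Finset.sum_sub_distrib] at h
  rw [h]
  refine Finset.sum_congr rfl fun s _ => ?_
  split_ifs with hi
  · rw [Finset.prod_update_of_mem hi, zero_mul, zero_mul, sub_zero]
  · rw [Finset.prod_update_of_notMem hi, sub_self]

theorem sum_prod_mul_complMinor_mul_sum (d : ι → R) (A : Matrix ι ι R) (u : ι → R) :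
    ∑ s : Finset ι, (∏ i ∈ s, d i) * complMinor A s * ∑ i ∈ s, u i =
      ∑ i, d i * (diagonal d + A).adjugate i i * u i := by
  simp_rw [mul_adjugate_diagonal_add_apply_self, Finset.sum_mul, Finset.mul_sum]
  rw [Finset.sum_comm]
  refine Finset.sum_congr rfl fun s _ => ?_
  simp only [ite_mul, zero_mul, Finset.sum_ite_mem, Finset.univ_inter]

theorem adjugate_eq_det_smul_inv {A : Matrix ι ι R} (h : IsUnit A.det) :
    A.adjugate = A.det • A⁻¹ := by
  rw [inv_def, smul_smul, Ring.mul_inverse_cancel _ h, one_smul]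

theorem sum_prod_mul_complMinor_mul_log_prod {A : Matrix ι ι ℝ} {d : ι → ℝ}
    (hdet : IsUnit (diagonal d + A).det) {r : ι → ℝ} (hr : ∀ i, r i ≠ 0) :
    ∑ s : Finset ι, (∏ i ∈ s, d i) * complMinor A s * Real.log (∏ i ∈ s, r i) =
      (diagonal d + A).det * ∑ i, d i * (diagonal d + A)⁻¹ i i * Real.log (r i) := by
  have h := sum_prod_mul_complMinor_mul_sum d A fun i => Real.log (r i)
  simp_rw [Real.log_prod fun i _ => hr i, h, adjugate_eq_det_smul_inv hdet, Matrix.smul_apply,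
    smul_eq_mul, Finset.mul_sum]
  exact Finset.sum_congr rfl fun i _ => by ring

/-- In logarithmic coordinates the determinant of `diagonal d + A` is a sum of exponentials, hence
log-convex, and this is its tangent inequality at `d`. -/
theorem log_det_diagonal_add_tangent_lt {A : Matrix ι ι ℝ} (hA : A.PosDef) {d e : ι → ℝ}
    (hd : ∀ i, 0 < d i) (he : ∀ i, 0 < e i) (hne : e ≠ d) :
    Real.log (diagonal d + A).det +
        ∑ i, d i * (diagonal d + A)⁻¹ i i * Real.log (e i / d i) <
      Real.log (diagonal e + A).det := by
  have hdetd := ((PosDef.diagonal hd).add hA).det_pos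
  have hdete := ((PosDef.diagonal he).add hA).det_pos
  have hprod : ∀ s : Finset ι, 0 < ∏ i ∈ s, d i := fun s => Finset.prod_pos fun i _ => hd i
  have hratio : ∀ i, 0 < e i / d i := fun i => div_pos (he i) (hd i)
  set weight : Finset ι → ℝ := fun s => (∏ i ∈ s, d i) * complMinor A s / (diagonal d + A).det
    with hweight
  have hsum : ∑ s, weight s = 1 := by
    rw [← Finset.sum_div, ← det_diagonal_add, div_self hdetd.ne']
  have hmean : ∑ s, weight s • ∏ i ∈ s, e i / d i =
      (diagonal e + A).det / (diagonal d + A).det := by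
    rw [det_diagonal_add e, Finset.sum_div]
    refine Finset.sum_congr rfl fun s _ => ?_
    rw [hweight, Finset.prod_div_distrib, smul_eq_mul]
    field_simp [(hprod s).ne']
  have hlogmean : ∑ s, weight s • Real.log (∏ i ∈ s, e i / d i) =
      ∑ i, d i * (diagonal d + A)⁻¹ i i * Real.log (e i / d i) := by
    simp_rw [hweight, smul_eq_mul, div_mul_eq_mul_div, ← Finset.sum_div,
      sum_prod_mul_complMinor_mul_log_prod hdetd.ne'.isUnit fun i => (hratio i).ne']
    exact mul_div_cancel_left₀ _ hdetd.ne'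
  obtain ⟨i, hi⟩ := Function.ne_iff.1 hne
  have hjensen := (strictConcaveOn_log_Ioi.lt_map_sum_iff_of_pos (t := Finset.univ) (w := weight)
    (fun s _ => div_pos (mul_pos (hprod s) (complMinor_pos hA s)) hdetd) hsum
    (fun s _ => Finset.prod_pos fun i (_ : i ∈ s) => hratio i)).2
    ⟨∅, Finset.mem_univ _, {i}, Finset.mem_univ _, by
      simpa [eq_comm, div_eq_one_iff_eq (hd i).ne'] using hi⟩
  rw [hmean, hlogmean, Real.log_div hdete.ne' hdetd.ne'] at hjensen
  linarith

end DiagonalPerturbation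

section Hadamard

variable {ι : Type*} [Fintype ι] [DecidableEq ι] {A : Matrix ι ι ℝ}

theorem log_det_lt_trace_sub_card (hA : A.PosDef) (hne : A ≠ 1) :
    Real.log A.det < A.trace - Fintype.card ι := by
  have hpos := hA.eigenvalues_pos
  obtain ⟨i, hi⟩ : ∃ i, hA.isHermitian.eigenvalues i ≠ 1 := by
    by_contra! hone
    refine hne ?_
    rw [hA.isHermitian.spectral_theorem, show RCLike.ofReal ∘ hA.isHermitian.eigenvalues =
      (1 : ι → ℝ) from funext fun i => by simp [hone i], Pi.one_def, diagonal_one, map_one]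
  have hdet : A.det = ∏ i, hA.isHermitian.eigenvalues i := by
    simpa using hA.isHermitian.det_eq_prod_eigenvalues
  have htrace : A.trace = ∑ i, hA.isHermitian.eigenvalues i := by
    simpa using hA.isHermitian.trace_eq_sum_eigenvalues
  calc Real.log A.det = ∑ i, Real.log (hA.isHermitian.eigenvalues i) := by
        rw [hdet, Real.log_prod fun i _ => (hpos i).ne']
    _ < ∑ i, (hA.isHermitian.eigenvalues i - 1) :=
        Finset.sum_lt_sum (fun i _ => Real.log_le_sub_one_of_pos (hpos i))
          ⟨i, Finset.mem_univ i, Real.log_lt_sub_one_of_pos (hpos i) hi⟩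
    _ = A.trace - Fintype.card ι := by
        rw [Finset.sum_sub_distrib, htrace, Finset.sum_const, Finset.card_univ, nsmul_one]

theorem det_lt_prod_diag_of_not_isDiag (hA : A.PosDef) (hdiag : ¬ A.IsDiag) :
    A.det < ∏ i, A i i := by
  have hpos : ∀ i, 0 < A i i := fun i => hA.diag_pos
  set D : Matrix ι ι ℝ := diagonal fun i => (√(A i i))⁻¹
  have hentry : ∀ i j, (D * A * D) i j = (√(A i i))⁻¹ * A i j * (√(A j j))⁻¹ := fun i j => by
    rw [mul_diagonal, diagonal_mul]
  have hdetD : D.det ^ 2 * ∏ i, A i i = 1 := by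
    rw [det_diagonal, ← Finset.prod_pow, ← Finset.prod_mul_distrib]
    refine Finset.prod_eq_one fun i _ => ?_
    rw [inv_pow, Real.sq_sqrt (hpos i).le, inv_mul_cancel₀ (hpos i).ne']
  have hDunit : IsUnit D := by
    rw [isUnit_iff_isUnit_det, isUnit_iff_ne_zero]
    rintro h0
    simp [h0] at hdetD
  have hN : (D * A * D).PosDef := by
    simpa [D, star_eq_conjTranspose] using hDunit.posDef_star_left_conjugate_iff.2 hA
  have hne : D * A * D ≠ 1 := fun h => hdiag fun i j hij => by
    have h0 := hentry i j
    rw [h, one_apply_ne hij, eq_comm] at h0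
    simpa [(Real.sqrt_pos.2 (hpos _)).ne'] using h0
  have htrace : (D * A * D).trace = Fintype.card ι := by
    rw [trace, ← Finset.card_univ, ← nsmul_one, ← Finset.sum_const]
    refine Finset.sum_congr rfl fun i _ => ?_
    rw [diag_apply, hentry, mul_right_comm, ← mul_inv, Real.mul_self_sqrt (hpos i).le,
      inv_mul_cancel₀ (hpos i).ne']
  have hlog := log_det_lt_trace_sub_card hN hne
  rw [htrace, sub_self, Real.log_neg_iff hN.det_pos, det_mul, det_mul, mul_right_comm, ← sq,
    ← hdetD] at hlog
  exact lt_of_mul_lt_mul_left hlog (sq_nonneg _)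

theorem isDiag_inv (h : A.IsDiag) : A⁻¹.IsDiag := by
  rw [← h.diagonal_diag, inv_diagonal]
  exact isDiag_diagonal _

theorem prod_inv_inv_apply_self_lt_det (hA : A.PosDef) (hdiag : ¬ A.IsDiag) :
    ∏ i, (A⁻¹ i i)⁻¹ < A.det := by
  have hinv : ¬ A⁻¹.IsDiag := fun h => hdiag <| by
    simpa [nonsing_inv_nonsing_inv _ hA.det_pos.ne'.isUnit] using isDiag_inv h
  have h := det_lt_prod_diag_of_not_isDiag hA.inv hinv
  rw [det_nonsing_inv, Ring.inverse_eq_inv'] at h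
  rw [Finset.prod_inv_distrib]
  exact inv_lt_of_inv_lt₀ hA.det_pos h

end Hadamard

section Stationarity

variable {ι : Type*}

/-- The convex combination `α Ψ + (1 - α) S` of covariance matrices. Its determinant governs the
order-`α` divergence between centred Gaussians with covariances `S` and `Ψ`. -/
def mixCov (α : ℝ) (S Ψ : Matrix ι ι ℝ) : Matrix ι ι ℝ :=
  α • Ψ + (1 - α) • S

theorem mixCov_zero (S Ψ : Matrix ι ι ℝ) : mixCov 0 S Ψ = S := by
  simp [mixCov]

theorem mixCov_one (S Ψ : Matrix ι ι ℝ) : mixCov 1 S Ψ = Ψ := by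
  simp [mixCov]

theorem posDef_mixCov {S Ψ : Matrix ι ι ℝ} (hS : S.PosDef) (hΨ : Ψ.PosDef) {α : ℝ}
    (hα : α ∈ Icc (0 : ℝ) 1) : (mixCov α S Ψ).PosDef :=
  posDef_smul_add_smul hΨ hS hα.1 (sub_nonneg.2 hα.2) (by ring)

variable {S : Matrix ι ι ℝ} {α β : ℝ} {a b d : ι → ℝ}

theorem mixCov_eq_smul_add_smul_mixCov (S Ψ : Matrix ι ι ℝ) (hα : α < 1) (β : ℝ) :
    mixCov β S Ψ = (1 - (1 - β) / (1 - α)) • Ψ + ((1 - β) / (1 - α)) • mixCov α S Ψ := by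
  have h : (1 - β) / (1 - α) * (1 - α) = 1 - β := div_mul_cancel₀ _ (sub_pos.2 hα).ne'
  generalize (1 - β) / (1 - α) = r at h ⊢
  obtain rfl : β = 1 - r * (1 - α) := by rw [h]; ring
  rw [mixCov, mixCov]
  module

variable [DecidableEq ι]

theorem isDiag_of_diagonal_eq_mixCov (hα : α < 1) (h : diagonal d = mixCov α S (diagonal d)) :
    S.IsDiag := by
  have hsmul : (1 - α) • S = (1 - α) • diagonal d := by
    rw [eq_comm, mixCov, ← eq_sub_iff_add_eq'] at h
    rw [h]
    module
  rw [smul_right_injective _ (sub_pos.2 hα).ne' hsmul]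
  exact isDiag_diagonal d

theorem posDef_smul_mixCov_sub_mixCov (hS : S.PosDef) (hα : α ∈ Ico (0 : ℝ) 1) {c : ℝ}
    (hc : 1 < c) (hab : ∀ i, a i ≤ c * b i) :
    (c • mixCov α S (diagonal b) - mixCov α S (diagonal a)).PosDef := by
  have hdiff : c • mixCov α S (diagonal b) - mixCov α S (diagonal a) =
      ((c - 1) * (1 - α)) • S + α • diagonal (c • b - a) := by
    rw [show diagonal (c • b - a) = c • diagonal b - diagonal a by
      rw [← diagonal_smul, diagonal_sub]; rfl, mixCov, mixCov]
    module
  have hpos : (diagonal (c • b - a)).PosSemidef :=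
    PosSemidef.diagonal fun i => sub_nonneg.2 (hab i)
  rw [hdiff]
  exact (hS.smul (mul_pos (sub_pos.2 hc) (sub_pos.2 hα.2))).add_posSemidef (hpos.smul hα.1)

variable [Fintype ι]

/-- `d` is a positive critical point of the order-`α` divergence from covariance `S` to a diagonal
covariance. The derivative is divided by the factor `α (1 - α)`, so that the notion remains
meaningful, and compact in `α`, at the end points `α = 0` and `α = 1`. -/
def IsStationary (α : ℝ) (S : Matrix ι ι ℝ) (d : ι → ℝ) : Prop :=
  (∀ i, 0 < d i) ∧ ∀ i, ((diagonal d - S) * (mixCov α S (diagonal d))⁻¹) i i = 0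

theorem IsStationary.posDef_diagonal (h : IsStationary α S d) : (diagonal d).PosDef :=
  PosDef.diagonal h.1

theorem inv_diagonal_eq_diagonal_inv (hd : ∀ i, d i ≠ 0) : (diagonal d)⁻¹ = diagonal d⁻¹ := by
  refine inv_eq_left_inv ?_
  rw [diagonal_mul_diagonal, ← diagonal_one]
  exact congrArg diagonal (funext fun i => inv_mul_cancel₀ (hd i))

theorem one_sub_mul_sub_mul_inv_mixCov (hdet : IsUnit (mixCov α S (diagonal d)).det) (i : ι) :
    (1 - α) * ((diagonal d - S) * (mixCov α S (diagonal d))⁻¹) i i =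
      d i * (mixCov α S (diagonal d))⁻¹ i i - 1 := by
  have hsub : (1 - α) • (diagonal d - S) = diagonal d - mixCov α S (diagonal d) := by
    rw [mixCov]; module
  rw [← smul_eq_mul, ← Matrix.smul_apply, ← Matrix.smul_mul, hsub, Matrix.sub_mul,
    mul_nonsing_inv _ hdet, Matrix.sub_apply, diagonal_mul, one_apply_eq]

theorem IsStationary.inv_mixCov_apply_self (hS : S.PosDef) (hα : α ∈ Icc (0 : ℝ) 1)
    (h : IsStationary α S d) (i : ι) : (mixCov α S (diagonal d))⁻¹ i i = (d i)⁻¹ := by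
  have hunit := (posDef_mixCov hS h.posDef_diagonal hα).det_pos.ne'.isUnit
  have heq := one_sub_mul_sub_mul_inv_mixCov hunit i
  rw [h.2 i, mul_zero, eq_comm, sub_eq_zero] at heq
  exact eq_inv_of_mul_eq_one_right heq

theorem isStationary_of_inv_mixCov_apply_self (hS : S.PosDef) (hα : α ∈ Ico (0 : ℝ) 1)
    (hd : ∀ i, 0 < d i) (h : ∀ i, (mixCov α S (diagonal d))⁻¹ i i = (d i)⁻¹) :
    IsStationary α S d := by
  refine ⟨hd, fun i => ?_⟩
  have hunit := (posDef_mixCov hS (PosDef.diagonal hd) (Ico_subset_Icc_self hα)).det_pos.ne'.isUnit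
  have heq := one_sub_mul_sub_mul_inv_mixCov hunit i
  rw [h i, mul_inv_cancel₀ (hd i).ne', sub_self] at heq
  exact (mul_eq_zero.1 heq).resolve_left (sub_pos.2 hα.2).ne'

theorem IsStationary.eq_inv_inv_apply_self (hS : S.PosDef) (h : IsStationary 0 S d) :
    d = fun i => (S⁻¹ i i)⁻¹ :=
  funext fun i => by
    have hinv := h.inv_mixCov_apply_self hS (left_mem_Icc.2 zero_le_one) i
    rw [mixCov_zero] at hinv
    rw [hinv, inv_inv]

theorem isStationary_one_iff (hS : S.PosDef) : IsStationary 1 S d ↔ d = S.diag := by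
  have hval (hd : ∀ i, 0 < d i) (i : ι) :
      ((diagonal d - S) * (mixCov 1 S (diagonal d))⁻¹) i i = 0 ↔ d i = S i i := by
    rw [mixCov_one, inv_diagonal_eq_diagonal_inv fun j => (hd j).ne', mul_diagonal,
      Matrix.sub_apply, diagonal_apply_eq, Pi.inv_apply, mul_eq_zero,
      or_iff_left (inv_ne_zero (hd i).ne'), sub_eq_zero]
  refine ⟨fun h => funext fun i => (hval h.1 i).1 (h.2 i), fun h => ?_⟩
  have hd : ∀ i, 0 < d i := fun i => h ▸ hS.diag_pos
  exact ⟨hd, fun i => (hval hd i).2 (congrFun h i)⟩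

theorem inv_mixCov_apply_self_le (hS : S.PosDef) (hα : α ∈ Icc (0 : ℝ) 1) (hd : ∀ i, 0 < d i)
    (i : ι) : (mixCov α S (diagonal d))⁻¹ i i ≤ α * (d i)⁻¹ + (1 - α) * S⁻¹ i i := by
  have h := inv_smul_add_smul_apply_self_le (PosDef.diagonal hd) hS hα.1 (sub_nonneg.2 hα.2)
    (by ring) i
  rwa [inv_diagonal_eq_diagonal_inv fun j => (hd j).ne', diagonal_apply_eq] at h

theorem inv_le_inv_mixCov_apply_self (hS : S.PosDef) (hα : α ∈ Icc (0 : ℝ) 1)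
    (hd : ∀ i, 0 < d i) (i : ι) :
    (α * d i + (1 - α) * S i i)⁻¹ ≤ (mixCov α S (diagonal d))⁻¹ i i := by
  simpa [mixCov] using inv_le_inv_apply_self (posDef_mixCov hS (PosDef.diagonal hd) hα) i

theorem inv_inv_apply_self_le_apply_self (hS : S.PosDef) (i : ι) : (S⁻¹ i i)⁻¹ ≤ S i i :=
  inv_le_of_inv_le₀ hS.diag_pos (inv_le_inv_apply_self hS i)

theorem IsStationary.mem_Icc (hS : S.PosDef) (hα : α ∈ Icc (0 : ℝ) 1) (h : IsStationary α S d) :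
    d ∈ Icc (fun i => (S⁻¹ i i)⁻¹) S.diag := by
  rcases hα.2.eq_or_lt with rfl | hα1
  · rw [(isStationary_one_iff hS).1 h]
    exact ⟨inv_inv_apply_self_le_apply_self hS, le_rfl⟩
  have hα1 : 0 < 1 - α := sub_pos.2 hα1
  refine ⟨fun i => inv_le_of_inv_le₀ (h.1 i) ?_, fun i => ?_⟩
  · have hle := inv_mixCov_apply_self_le hS hα h.1 i
    rw [h.inv_mixCov_apply_self hS hα] at hle
    exact le_of_mul_le_mul_left (by linarith) hα1
  · have hle := inv_le_inv_mixCov_apply_self hS hα h.1 i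
    have hmix : 0 < α * d i + (1 - α) * S i i :=
      add_pos_of_nonneg_of_pos (mul_nonneg hα.1 (h.1 i).le) (mul_pos hα1 hS.diag_pos)
    rw [h.inv_mixCov_apply_self hS hα, inv_le_inv₀ hmix (h.1 i)] at hle
    exact le_of_mul_le_mul_left (show _ ≤ (1 - α) * S i i by linarith) hα1

-- Scaling `b` by `c = max (a i / b i)` dominates `a` and touches it at some `k`; if `c > 1` then
-- strict antitonicity of the inverse violates the hypothesis on `a` at that `k`.
theorem IsStationary.le_of_inv_mixCov_apply_self_le (hS : S.PosDef) (hα : α ∈ Ico (0 : ℝ) 1)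
    (hb : IsStationary α S b) (ha : ∀ i, 0 < a i)
    (hsub : ∀ i, (mixCov α S (diagonal a))⁻¹ i i ≤ (a i)⁻¹) : a ≤ b := by
  have hα' := Ico_subset_Icc_self hα
  by_contra hle
  obtain ⟨j, hj⟩ : ∃ j, b j < a j := by simpa [Pi.le_def] using hle
  obtain ⟨k, -, hmax⟩ := Finset.exists_max_image Finset.univ (fun i => a i / b i) ⟨j, by simp⟩
  set c := a k / b k
  have hc : 1 < c := ((one_lt_div (hb.1 j)).2 hj).trans_le (hmax j (Finset.mem_univ j))
  have hab : ∀ i, a i ≤ c * b i := fun i =>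
    (div_le_iff₀ (hb.1 i)).1 (hmax i (Finset.mem_univ i))
  have hlt := (inv_apply_self_lt_of_posDef_sub (posDef_mixCov hS (PosDef.diagonal ha) hα')
    (posDef_smul_mixCov_sub_mixCov hS hα hc hab) k).trans_le (hsub k)
  have hdet := (posDef_mixCov hS hb.posDef_diagonal hα').det_pos.ne'.isUnit
  have hinv : (c • mixCov α S (diagonal b))⁻¹ = c⁻¹ • (mixCov α S (diagonal b))⁻¹ :=
    inv_smul' _ (Units.mk0 c (by positivity)) hdet
  rw [hinv, Matrix.smul_apply, hb.inv_mixCov_apply_self hS hα', smul_eq_mul, ← mul_inv,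
    div_mul_cancel₀ _ (hb.1 k).ne'] at hlt
  exact hlt.false

theorem IsStationary.unique (hS : S.PosDef) (hα : α ∈ Icc (0 : ℝ) 1)
    (ha : IsStationary α S a) (hb : IsStationary α S b) : a = b := by
  rcases hα.2.eq_or_lt with rfl | hα1
  · rw [(isStationary_one_iff hS).1 ha, (isStationary_one_iff hS).1 hb]
  · exact le_antisymm
      (hb.le_of_inv_mixCov_apply_self_le hS ⟨hα.1, hα1⟩ ha.1 fun i =>
        (ha.inv_mixCov_apply_self hS hα i).le)
      (ha.le_of_inv_mixCov_apply_self_le hS ⟨hα.1, hα1⟩ hb.1 fun i =>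
        (hb.inv_mixCov_apply_self hS hα i).le)

theorem IsStationary.lt_of_lt (hS : S.PosDef) (hdiag : ¬ S.IsDiag) (hα : 0 ≤ α) (hαβ : α < β)
    (hβ : β < 1) (ha : IsStationary α S a) (hb : IsStationary β S b) : a < b := by
  have hα1 : α < 1 := hαβ.trans hβ
  obtain ⟨r, hr⟩ : ∃ r, r = (1 - β) / (1 - α) := ⟨_, rfl⟩
  have hr0 : 0 < r := hr ▸ div_pos (sub_pos.2 hβ) (sub_pos.2 hα1)
  have hr1 : 0 < 1 - r := by
    rw [sub_pos, hr, div_lt_one (sub_pos.2 hα1)]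
    linarith
  have hM := posDef_mixCov hS ha.posDef_diagonal ⟨hα, hα1.le⟩
  have hmix : mixCov β S (diagonal a) = (1 - r) • diagonal a + r • mixCov α S (diagonal a) :=
    hr ▸ mixCov_eq_smul_add_smul_mixCov S _ hα1 β
  have hcomb : ∀ i, (1 - r) * (diagonal a)⁻¹ i i + r * (mixCov α S (diagonal a))⁻¹ i i =
      (a i)⁻¹ := fun i => by
    rw [ha.inv_mixCov_apply_self hS ⟨hα, hα1.le⟩,
      inv_diagonal_eq_diagonal_inv fun j => (ha.1 j).ne', diagonal_apply_eq, Pi.inv_apply]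
    ring
  have hβ' : β ∈ Ico (0 : ℝ) 1 := ⟨hα.trans hαβ.le, hβ⟩
  refine (hb.le_of_inv_mixCov_apply_self_le hS hβ' ha.1 fun i => ?_).lt_of_ne ?_
  · rw [hmix, ← hcomb i]
    exact inv_smul_add_smul_apply_self_le ha.posDef_diagonal hM hr1.le hr0.le (by ring) i
  · rintro rfl
    refine hdiag (isDiag_of_diagonal_eq_mixCov (d := a) hα1 ?_)
    refine eq_of_inv_smul_add_smul_apply_self_eq ha.posDef_diagonal hM hr1 hr0 (by ring)
      fun i => ?_
    rw [← hmix, hcomb, hb.inv_mixCov_apply_self hS (Ico_subset_Icc_self hβ')]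

/-- The self-map of the box `[(S⁻¹ i i)⁻¹, S i i]` whose fixed points are, for `α < 1`, the
stationary points. -/
noncomputable def stationaryMap (α : ℝ) (S : Matrix ι ι ℝ) (d : ι → ℝ) : ι → ℝ :=
  fun i => ((mixCov α S (diagonal d))⁻¹ i i)⁻¹

theorem pos_of_mem_Icc (hS : S.PosDef) (hd : d ∈ Icc (fun i => (S⁻¹ i i)⁻¹) S.diag) (i : ι) :
    0 < d i :=
  (inv_pos.2 hS.inv.diag_pos).trans_le (hd.1 i)

theorem stationaryMap_mem_Icc (hS : S.PosDef) (hα : α ∈ Icc (0 : ℝ) 1)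
    (hd : d ∈ Icc (fun i => (S⁻¹ i i)⁻¹) S.diag) :
    stationaryMap α S d ∈ Icc (fun i => (S⁻¹ i i)⁻¹) S.diag := by
  have hpos := pos_of_mem_Icc hS hd
  have hM : (mixCov α S (diagonal d)).PosDef := posDef_mixCov hS (PosDef.diagonal hpos) hα
  have : 0 ≤ 1 - α := sub_nonneg.2 hα.2
  refine ⟨fun i => inv_anti₀ hM.inv.diag_pos ?_, fun i => inv_le_of_inv_le₀ hS.diag_pos ?_⟩
  · have hle : (d i)⁻¹ ≤ S⁻¹ i i := inv_le_of_inv_le₀ hS.inv.diag_pos (hd.1 i)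
    calc (mixCov α S (diagonal d))⁻¹ i i ≤ α * (d i)⁻¹ + (1 - α) * S⁻¹ i i :=
          inv_mixCov_apply_self_le hS hα hpos i
      _ ≤ α * S⁻¹ i i + (1 - α) * S⁻¹ i i := by gcongr; exact hα.1
      _ = S⁻¹ i i := by ring
  · have hmix : 0 < α * d i + (1 - α) * S i i := by
      simpa [mixCov] using hM.diag_pos (i := i)
    have hle : d i ≤ S i i := hd.2 i
    refine (inv_anti₀ hmix ?_).trans (inv_le_inv_mixCov_apply_self hS hα hpos i)
    calc α * d i + (1 - α) * S i i ≤ α * S i i + (1 - α) * S i i := by gcongr; exact hα.1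
      _ = S i i := by ring

theorem stationaryMap_le_stationaryMap (hS : S.PosDef) (hα : α ∈ Icc (0 : ℝ) 1)
    (ha : ∀ i, 0 < a i) (hb : ∀ i, 0 < b i) (hab : a ≤ b) :
    stationaryMap α S a ≤ stationaryMap α S b := by
  have hA := posDef_mixCov hS (PosDef.diagonal ha) hα
  have hB := posDef_mixCov hS (PosDef.diagonal hb) hα
  refine fun i => inv_anti₀ hB.inv.diag_pos (inv_apply_self_le_of_posSemidef_sub hA hB ?_ i)
  rw [mixCov, mixCov, add_sub_add_right_eq_sub, ← smul_sub, diagonal_sub]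
  exact (PosSemidef.diagonal fun i => sub_nonneg.2 (hab i)).smul hα.1

theorem exists_isStationary_of_lt_one (hS : S.PosDef) (hα : α ∈ Ico (0 : ℝ) 1) :
    ∃ d, IsStationary α S d := by
  have hα' := Ico_subset_Icc_self hα
  have : Fact ((fun i => (S⁻¹ i i)⁻¹) ≤ S.diag) := ⟨inv_inv_apply_self_le_apply_self hS⟩
  let Φ : Icc (fun i => (S⁻¹ i i)⁻¹) S.diag →o Icc (fun i => (S⁻¹ i i)⁻¹) S.diag :=
    ⟨fun d => ⟨stationaryMap α S d, stationaryMap_mem_Icc hS hα' d.2⟩, fun a b hab =>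
      stationaryMap_le_stationaryMap hS hα' (pos_of_mem_Icc hS a.2) (pos_of_mem_Icc hS b.2) hab⟩
  have hfix : stationaryMap α S Φ.lfp = Φ.lfp := congrArg Subtype.val Φ.map_lfp
  refine ⟨Φ.lfp, isStationary_of_inv_mixCov_apply_self hS hα (pos_of_mem_Icc hS Φ.lfp.2)
    fun i => ?_⟩
  rw [← inv_inv ((mixCov α S _)⁻¹ i i)]
  exact congrArg Inv.inv (congrFun hfix i)

theorem exists_isStationary (hS : S.PosDef) (hα : α ∈ Icc (0 : ℝ) 1) :
    ∃ d, IsStationary α S d := by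
  rcases hα.2.eq_or_lt with rfl | hα1
  · exact ⟨S.diag, (isStationary_one_iff hS).2 rfl⟩
  · exact exists_isStationary_of_lt_one hS ⟨hα.1, hα1⟩

theorem isCompact_setOf_isStationary (hS : S.PosDef) :
    IsCompact {p : ℝ × (ι → ℝ) | p.1 ∈ Icc 0 1 ∧ IsStationary p.1 S p.2} := by
  let M (p : ℝ × (ι → ℝ)) : Matrix ι ι ℝ := mixCov p.1 S (diagonal p.2)
  have hcont : Continuous fun p : ℝ × (ι → ℝ) => (diagonal p.2 - S) * (M p).adjugate := by
    unfold M mixCov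
    fun_prop
  -- The adjugate, unlike the inverse, is continuous everywhere.
  have heq : {p : ℝ × (ι → ℝ) | p.1 ∈ Icc 0 1 ∧ IsStationary p.1 S p.2} =
      Icc 0 1 ×ˢ Icc (fun i => (S⁻¹ i i)⁻¹) S.diag ∩
        {p | ∀ i, ((diagonal p.2 - S) * (M p).adjugate) i i = 0} := by
    have hadj (p : ℝ × (ι → ℝ)) (hp : p.1 ∈ Icc 0 1) (hd : ∀ i, 0 < p.2 i) (i : ι) :
        ((diagonal p.2 - S) * (M p).adjugate) i i = 0 ↔
          ((diagonal p.2 - S) * (M p)⁻¹) i i = 0 := by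
      have hdet := (posDef_mixCov hS (PosDef.diagonal hd) hp).det_pos.ne'
      rw [adjugate_eq_det_smul_inv hdet.isUnit, Matrix.mul_smul, Matrix.smul_apply, smul_eq_mul,
        mul_eq_zero, or_iff_right hdet]
    ext p
    constructor
    · rintro ⟨hp, h⟩
      exact ⟨⟨hp, h.mem_Icc hS hp⟩, fun i => (hadj p hp h.1 i).2 (h.2 i)⟩
    · rintro ⟨⟨hp, hbox⟩, h⟩
      have hd := pos_of_mem_Icc hS hbox
      exact ⟨hp, hd, fun i => (hadj p hp hd i).1 (h i)⟩
  rw [heq]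
  refine (isCompact_Icc.prod isCompact_Icc).inter_right ?_
  simp only [ofPred_forall]
  exact isClosed_iInter fun i => isClosed_eq (hcont.matrix_elem i i) continuous_const

theorem continuousOn_of_isCompact_graphOn {X Y : Type*} [TopologicalSpace X] [T2Space X]
    [TopologicalSpace Y] {f : X → Y} {s : Set X} (h : IsCompact (s.graphOn f)) :
    ContinuousOn f s := by
  refine continuousOn_iff_isClosed.2 fun C hC =>
    ⟨Prod.fst '' (s.graphOn f ∩ Prod.snd ⁻¹' C),
      ((h.inter_right (hC.preimage continuous_snd)).image continuous_fst).isClosed, ?_⟩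
  ext x
  constructor
  · rintro ⟨hfx, hx⟩
    exact ⟨⟨(x, f x), ⟨⟨x, hx, rfl⟩, hfx⟩, rfl⟩, hx⟩
  · rintro ⟨⟨_, ⟨⟨y, -, rfl⟩, hfy⟩, rfl⟩, hx⟩
    exact ⟨hfy, hx⟩

theorem exists_continuousOn_isStationary (hS : S.PosDef) :
    ∃ δ : ℝ → ι → ℝ, ContinuousOn δ (Icc 0 1) ∧ ∀ α ∈ Icc (0 : ℝ) 1, IsStationary α S (δ α) := by
  choose! δ hδ using fun α (hα : α ∈ Icc (0 : ℝ) 1) => exists_isStationary hS hα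
  refine ⟨δ, continuousOn_of_isCompact_graphOn ?_, hδ⟩
  convert isCompact_setOf_isStationary hS using 1
  ext ⟨α, d⟩
  constructor
  · rintro ⟨β, hβ, hp⟩
    obtain ⟨rfl, rfl⟩ := Prod.mk.inj hp
    exact ⟨hβ, hδ _ hβ⟩
  · rintro ⟨hα, hd⟩
    exact ⟨α, hα, Prod.ext rfl ((hδ α hα).unique hS hα hd)⟩

theorem existsUnique_isStationary_prod_eq_det (hS : S.PosDef) (hdiag : ¬ S.IsDiag) :
    ∃! α, α ∈ Ioo (0 : ℝ) 1 ∧ ∃ d, IsStationary α S d ∧ ∏ i, d i = S.det := by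
  obtain ⟨δ, hcont, hδ⟩ := exists_continuousOn_isStationary hS
  have hzero : ∏ i, δ 0 i < S.det := by
    rw [(hδ 0 (left_mem_Icc.2 zero_le_one)).eq_inv_inv_apply_self hS]
    exact prod_inv_inv_apply_self_lt_det hS hdiag
  have hone : S.det < ∏ i, δ 1 i := by
    rw [(isStationary_one_iff hS).1 (hδ 1 (right_mem_Icc.2 zero_le_one))]
    exact det_lt_prod_diag_of_not_isDiag hS hdiag
  have hprod : ContinuousOn (fun α => ∏ i, δ α i) (Icc 0 1) :=
    continuousOn_finsetProd _ fun i _ => (continuous_apply i).comp_continuousOn hcont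
  obtain ⟨α, hα, hdet⟩ := intermediate_value_Ioo zero_le_one hprod ⟨hzero, hone⟩
  refine ⟨α, ⟨hα, δ α, hδ α (Ioo_subset_Icc_self hα), hdet⟩, ?_⟩
  have hmono {β γ : ℝ} (hβ : 0 < β) (hβγ : β < γ) (hγ : γ < 1) {a b : ι → ℝ}
      (ha : IsStationary β S a) (hb : IsStationary γ S b) : ∏ i, a i < ∏ i, b i := by
    obtain ⟨hle, k, hk⟩ := Pi.lt_def.1 (ha.lt_of_lt hS hdiag hβ.le hβγ hγ hb)
    exact Finset.prod_lt_prod (fun i _ => ha.1 i) (fun i _ => hle i) ⟨k, Finset.mem_univ k, hk⟩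
  rintro β ⟨hβ, d, hd, hdet'⟩
  have hα' := hδ α (Ioo_subset_Icc_self hα)
  rcases lt_trichotomy β α with h | h | h
  · exact absurd (hdet'.trans hdet.symm) (hmono hβ.1 h hα.2 hd hα').ne
  · exact h
  · exact absurd (hdet.trans hdet'.symm) (hmono hα.1 h hβ.2 hα' hd).ne

/-- The Jensen gap of `log det` at the convex combination `α Ψ + (1 - α) S`, which up to an
increasing reparametrization is the order-`α` divergence between centred Gaussians. -/
noncomputable def logDetGap (α : ℝ) (S Ψ : Matrix ι ι ℝ) : ℝ :=
  Real.log (mixCov α S Ψ).det - (α * Real.log Ψ.det + (1 - α) * Real.log S.det)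

theorem IsStationary.logDetGap_lt (hS : S.PosDef) (hα : α ∈ Ioo (0 : ℝ) 1)
    (hd : IsStationary α S d) {e : ι → ℝ} (he : ∀ i, 0 < e i) (hne : e ≠ d) :
    logDetGap α S (diagonal d) < logDetGap α S (diagonal e) := by
  have hα0 : 0 < α := hα.1
  have hmix (x : ι → ℝ) : diagonal (α • x) + (1 - α) • S = mixCov α S (diagonal x) := by
    rw [diagonal_smul, mixCov]
  have htangent := log_det_diagonal_add_tangent_lt (hS.smul (sub_pos.2 hα.2))
    (d := α • d) (e := α • e) (fun i => mul_pos hα0 (hd.1 i)) (fun i => mul_pos hα0 (he i))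
    fun h => hne (smul_right_injective _ hα0.ne' h)
  have hterm (i : ι) : (α • d) i * (mixCov α S (diagonal d))⁻¹ i i *
      Real.log ((α • e) i / (α • d) i) = α * (Real.log (e i) - Real.log (d i)) := by
    rw [hd.inv_mixCov_apply_self hS (Ioo_subset_Icc_self hα), Pi.smul_apply, Pi.smul_apply,
      smul_eq_mul, smul_eq_mul, mul_div_mul_left _ _ hα0.ne',
      Real.log_div (he i).ne' (hd.1 i).ne', mul_inv_cancel_right₀ (hd.1 i).ne']
  simp only [hmix, hterm, ← Finset.mul_sum, Finset.sum_sub_distrib] at htangent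
  rw [logDetGap, logDetGap, det_diagonal, det_diagonal, Real.log_prod fun i _ => (he i).ne',
    Real.log_prod fun i _ => (hd.1 i).ne']
  linarith

end Stationarity

section GaussianDensity

open scoped MatrixOrder

variable {ι : Type*} [Fintype ι]

theorem integral_cexp_neg_half_mul_sq_norm_add (t : EuclideanSpace ℝ ι) :
    ∫ x : EuclideanSpace ℝ ι,
        Complex.exp (-(1 / 2) * (‖x‖ : ℂ) ^ 2 + Complex.I * ((inner ℝ t x : ℝ) : ℂ)) =
      Complex.exp ((Fintype.card ι / 2 * Real.log (2 * Real.pi) - ‖t‖ ^ 2 / 2 : ℝ) : ℂ) := by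
  have hbase : (Real.pi : ℂ) / (1 / 2) = ((2 * Real.pi : ℝ) : ℂ) := by push_cast; ring
  have hne : ((2 * Real.pi : ℝ) : ℂ) ≠ 0 := Complex.ofReal_ne_zero.2 Real.two_pi_pos.ne'
  rw [GaussianFourier.integral_cexp_neg_mul_sq_norm_add (by norm_num), finrank_euclideanSpace,
    hbase, Complex.cpow_def_of_ne_zero hne, ← Complex.ofReal_log Real.two_pi_pos.le,
    ← Complex.exp_add, Complex.I_sq]
  congr 1
  push_cast
  ring

variable [DecidableEq ι]

/-- The logarithm of the Lebesgue density of the Gaussian with mean `μ` and covariance `S`,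
meaningful for positive definite `S`. -/
noncomputable def gaussianLogDensity (μ : EuclideanSpace ℝ ι) (S : Matrix ι ι ℝ)
    (z : EuclideanSpace ℝ ι) : ℝ :=
  -(Fintype.card ι / 2 * Real.log (2 * Real.pi)) - 1 / 2 * Real.log S.det
    - 1 / 2 * ((z - μ).ofLp ⬝ᵥ S⁻¹ *ᵥ (z - μ).ofLp)

theorem continuous_gaussianLogDensity (μ : EuclideanSpace ℝ ι) (S : Matrix ι ι ℝ) :
    Continuous (gaussianLogDensity μ S) := by
  have h : Continuous fun z : EuclideanSpace ℝ ι => (z - μ).ofLp := by fun_prop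
  exact continuous_const.sub (continuous_const.mul
    (h.dotProduct (continuous_const.matrix_mulVec h)))

theorem measurable_ofReal_exp_gaussianLogDensity (μ : EuclideanSpace ℝ ι) (S : Matrix ι ι ℝ) :
    Measurable fun z => ENNReal.ofReal (Real.exp (gaussianLogDensity μ S z)) :=
  (Real.continuous_exp.comp (continuous_gaussianLogDensity μ S)).measurable.ennreal_ofReal

theorem gaussianLogDensity_zero_one (x : EuclideanSpace ℝ ι) :
    gaussianLogDensity 0 1 x =
      -(Fintype.card ι / 2 * Real.log (2 * Real.pi)) - 1 / 2 * ‖x‖ ^ 2 := by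
  simp [gaussianLogDensity, EuclideanSpace.real_norm_sq_eq, dotProduct, ← sq]

theorem integrable_exp_gaussianLogDensity_zero_one :
    Integrable fun x : EuclideanSpace ℝ ι => Real.exp (gaussianLogDensity 0 1 x) := by
  have h := (GaussianFourier.integrable_cexp_neg_mul_sq_norm_add (b := (1 / 2 : ℂ))
    (by norm_num) 0 (0 : EuclideanSpace ℝ ι)).re
  refine (h.const_mul (Real.exp (-(Fintype.card ι / 2 * Real.log (2 * Real.pi))))).congr
    (Filter.Eventually.of_forall fun x => ?_)
  have hreal : (-(1 / 2 : ℂ) * (‖x‖ : ℂ) ^ 2 + 0 * ((inner ℝ 0 x : ℝ) : ℂ)) =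
      ((-(1 / 2) * ‖x‖ ^ 2 : ℝ) : ℂ) := by push_cast; ring
  simp only [hreal]
  rw [gaussianLogDensity_zero_one, sub_eq_add_neg, Real.exp_add, ← Complex.ofReal_exp,
    RCLike.re_to_complex, Complex.ofReal_re, neg_mul]

theorem stdGaussian_eq_withDensity :
    stdGaussian (EuclideanSpace ℝ ι) =
      volume.withDensity fun x => ENNReal.ofReal (Real.exp (gaussianLogDensity 0 1 x)) := by
  have : IsFiniteMeasure ((volume : Measure (EuclideanSpace ℝ ι)).withDensity
      fun x => ENNReal.ofReal (Real.exp (gaussianLogDensity 0 1 x))) :=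
    isFiniteMeasure_withDensity_ofReal integrable_exp_gaussianLogDensity_zero_one.2
  refine Measure.ext_of_charFun (funext fun t => ?_)
  have hfactor : ∀ x : EuclideanSpace ℝ ι,
      (ENNReal.ofReal (Real.exp (gaussianLogDensity 0 1 x))).toReal •
        Complex.exp (((inner ℝ x t : ℝ) : ℂ) * Complex.I) =
      Complex.exp (-(Fintype.card ι / 2 * Real.log (2 * Real.pi)) : ℝ) *
        Complex.exp (-(1 / 2) * (‖x‖ : ℂ) ^ 2 + Complex.I * ((inner ℝ t x : ℝ) : ℂ)) := by
    intro x
    rw [ENNReal.toReal_ofReal (Real.exp_pos _).le, gaussianLogDensity_zero_one,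
      Complex.real_smul, Complex.ofReal_exp, ← Complex.exp_add, ← Complex.exp_add,
      real_inner_comm]
    congr 1
    push_cast
    ring
  rw [charFun_stdGaussian, charFun_apply, integral_withDensity_eq_integral_toReal_smul
    (measurable_ofReal_exp_gaussianLogDensity 0 1) (by simp)]
  simp_rw [hfactor]
  rw [integral_const_mul, integral_cexp_neg_half_mul_sq_norm_add, ← Complex.exp_add]
  congr 1
  push_cast
  ring

theorem bijective_toEuclideanCLM {A : Matrix ι ι ℝ} (hA : IsUnit A.det) :
    Function.Bijective (toEuclideanCLM (𝕜 := ℝ) A) :=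
  ContinuousLinearMap.isUnit_iff_bijective.1
    (((isUnit_iff_isUnit_det A).2 hA).map (toEuclideanCLM (𝕜 := ℝ)))

variable {S : Matrix ι ι ℝ}

theorem det_sqrt_of_posDef (hS : S.PosDef) : (CFC.sqrt S).det = √S.det := by
  simpa using hS.posSemidef.det_sqrt

theorem isUnit_det_sqrt (hS : S.PosDef) : IsUnit (CFC.sqrt S).det := by
  rw [det_sqrt_of_posDef hS]
  exact (Real.sqrt_pos.2 hS.det_pos).ne'.isUnit

theorem dotProduct_inv_mulVec_sqrt_mulVec (hS : S.PosDef) (x : ι → ℝ) :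
    (CFC.sqrt S *ᵥ x) ⬝ᵥ S⁻¹ *ᵥ (CFC.sqrt S *ᵥ x) = x ⬝ᵥ x := by
  have hsq : CFC.sqrt S * CFC.sqrt S = S := CFC.sqrt_mul_sqrt_self _ hS.posSemidef.nonneg
  have hsymm : (CFC.sqrt S)ᵀ = CFC.sqrt S := by
    simpa using (nonneg_iff_posSemidef.1 (CFC.sqrt_nonneg S)).isHermitian.eq
  have hinv : S⁻¹ = (CFC.sqrt S)⁻¹ * (CFC.sqrt S)⁻¹ := by rw [← Matrix.mul_inv_rev, hsq]
  rw [mulVec_mulVec, hinv, nonsing_inv_mul_cancel_right _ _ (isUnit_det_sqrt hS),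
    dotProduct_comm, dotProduct_mulVec, ← mulVec_transpose, hsymm, mulVec_mulVec,
    mul_nonsing_inv _ (isUnit_det_sqrt hS), one_mulVec]

theorem gaussianLogDensity_add_sqrt (hS : S.PosDef) (μ x : EuclideanSpace ℝ ι) :
    gaussianLogDensity μ S (μ + toEuclideanCLM (𝕜 := ℝ) (CFC.sqrt S) x) =
      gaussianLogDensity 0 1 x - 1 / 2 * Real.log S.det := by
  rw [gaussianLogDensity, gaussianLogDensity, add_sub_cancel_left, ofLp_toEuclideanCLM,
    dotProduct_inv_mulVec_sqrt_mulVec hS, sub_zero, inv_one, one_mulVec, det_one, Real.log_one]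
  ring

theorem multivariateGaussian_eq_withDensity (hS : S.PosDef) (μ : EuclideanSpace ℝ ι) :
    multivariateGaussian μ S =
      volume.withDensity fun x => ENNReal.ofReal (Real.exp (gaussianLogDensity μ S x)) := by
  set L := toEuclideanCLM (𝕜 := ℝ) (CFC.sqrt S)
  have hbij : Function.Bijective fun x => μ + L x :=
    (AddGroup.addLeft_bijective μ).comp (bijective_toEuclideanCLM (isUnit_det_sqrt hS))
  have hmeas : Measurable fun x => μ + L x := by fun_prop
  have hjacobian : |L.det| = Real.exp (1 / 2 * Real.log S.det) := by
    have hdet : L.det = √S.det := (LinearMap.det_toLpLin 2 _).trans (det_sqrt_of_posDef hS)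
    rw [hdet, abs_of_nonneg (Real.sqrt_nonneg _), Real.sqrt_eq_rpow,
      Real.rpow_def_of_pos hS.det_pos, mul_comm]
  ext B hB
  rw [multivariateGaussian, Measure.map_apply hmeas hB, stdGaussian_eq_withDensity,
    withDensity_apply _ (hmeas hB), withDensity_apply _ hB]
  conv_rhs => rw [← image_preimage_eq B hbij.surjective]
  rw [lintegral_image_eq_lintegral_abs_det_fderiv_mul volume (hmeas hB)
    (fun x _ => (L.hasFDerivAt.const_add μ).hasFDerivWithinAt) hbij.injective.injOn]
  refine lintegral_congr fun x => ?_
  rw [hjacobian, ← ENNReal.ofReal_mul (Real.exp_pos _).le, gaussianLogDensity_add_sqrt hS,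
    ← Real.exp_add, add_sub_cancel]

theorem lintegral_exp_gaussianLogDensity (hS : S.PosDef) (μ : EuclideanSpace ℝ ι) :
    ∫⁻ z, ENNReal.ofReal (Real.exp (gaussianLogDensity μ S z)) = 1 := by
  have h : multivariateGaussian μ S univ = 1 := measure_univ
  rwa [multivariateGaussian_eq_withDensity hS μ, withDensity_apply _ MeasurableSet.univ,
    setLIntegral_univ] at h

theorem integrable_exp_gaussianLogDensity (hS : S.PosDef) (μ : EuclideanSpace ℝ ι) :
    Integrable fun z => Real.exp (gaussianLogDensity μ S z) := by
  refine ⟨(Real.continuous_exp.comp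
    (continuous_gaussianLogDensity μ S)).aestronglyMeasurable, ?_⟩
  rw [hasFiniteIntegral_iff_ofReal (Filter.Eventually.of_forall fun z => (Real.exp_pos _).le),
    lintegral_exp_gaussianLogDensity hS]
  exact ENNReal.one_lt_top

theorem integral_exp_gaussianLogDensity (hS : S.PosDef) (μ : EuclideanSpace ℝ ι) :
    ∫ z, Real.exp (gaussianLogDensity μ S z) = 1 := by
  rw [integral_eq_lintegral_of_nonneg_ae (Filter.Eventually.of_forall fun z => (Real.exp_pos _).le)
    (integrable_exp_gaussianLogDensity hS μ).1, lintegral_exp_gaussianLogDensity hS,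
    ENNReal.toReal_one]

theorem integral_gaussianLogDensity (hS : S.PosDef) (μ : EuclideanSpace ℝ ι) :
    ∫ z, gaussianLogDensity μ S z ∂multivariateGaussian μ S =
      ∫ x, gaussianLogDensity 0 1 x ∂stdGaussian (EuclideanSpace ℝ ι) -
        1 / 2 * Real.log S.det := by
  have hint : Integrable (gaussianLogDensity 0 1) (stdGaussian (EuclideanSpace ℝ ι)) := by
    have hsq : Integrable (fun x => ‖x‖ ^ 2) (stdGaussian (EuclideanSpace ℝ ι)) :=
      (IsGaussian.memLp_two_id (μ := stdGaussian (EuclideanSpace ℝ ι))).integrable_norm_pow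
        two_ne_zero
    rw [funext gaussianLogDensity_zero_one]
    exact (integrable_const _).sub (hsq.const_mul _)
  rw [multivariateGaussian, integral_map (by fun_prop)
    (continuous_gaussianLogDensity μ S).aestronglyMeasurable]
  simp_rw [gaussianLogDensity_add_sqrt hS]
  rw [integral_sub hint (integrable_const _), integral_const, probReal_univ, one_smul]

end GaussianDensity

section GaussianFunctionals

variable {n : ℕ} {S Ψ : Matrix (Fin n) (Fin n) ℝ}

theorem density_multivariateGaussian (hS : S.PosDef) (μ : EuclideanSpace ℝ (Fin n)) :
    density (multivariateGaussian μ S) =ᵐ[volume] fun z => Real.exp (gaussianLogDensity μ S z) := by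
  rw [multivariateGaussian_eq_withDensity hS μ]
  filter_upwards [Measure.rnDeriv_withDensity volume
    (measurable_ofReal_exp_gaussianLogDensity μ S)] with z hz
  rw [density, hz, ENNReal.toReal_ofReal (Real.exp_pos _).le]

theorem entropy_multivariateGaussian (hS : S.PosDef) (μ : EuclideanSpace ℝ (Fin n)) :
    entropy (multivariateGaussian μ S) = 1 / 2 * Real.log S.det -
      ∫ x, gaussianLogDensity 0 1 x ∂stdGaussian (EuclideanSpace ℝ (Fin n)) := by
  have hexpect : ∫ z, density (multivariateGaussian μ S) z *
      Real.log (density (multivariateGaussian μ S) z) =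
      ∫ z, gaussianLogDensity μ S z ∂multivariateGaussian μ S := by
    rw [multivariateGaussian_eq_withDensity hS μ, integral_withDensity_eq_integral_toReal_smul
      (measurable_ofReal_exp_gaussianLogDensity μ S) (by simp),
      ← multivariateGaussian_eq_withDensity hS μ]
    refine integral_congr_ae ?_
    filter_upwards [density_multivariateGaussian hS μ] with z hz
    rw [hz, Real.log_exp, ENNReal.toReal_ofReal (Real.exp_pos _).le, smul_eq_mul]
  rw [entropy, hexpect, integral_gaussianLogDensity hS, neg_sub]

theorem entropy_multivariateGaussian_eq_iff (hS : S.PosDef) (hΨ : Ψ.PosDef)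
    (μ ν : EuclideanSpace ℝ (Fin n)) :
    entropy (multivariateGaussian ν Ψ) = entropy (multivariateGaussian μ S) ↔ Ψ.det = S.det := by
  rw [entropy_multivariateGaussian hS, entropy_multivariateGaussian hΨ, sub_left_inj,
    mul_right_inj' (by norm_num), Real.log_injOn_pos.eq_iff hΨ.det_pos hS.det_pos]

theorem generalizedVariance_multivariateGaussian (hS : S.PosSemidef)
    (μ : EuclideanSpace ℝ (Fin n)) :
    generalizedVariance (multivariateGaussian μ S) = S.det :=
  congrArg det (Matrix.ext fun i j => covariance_eval_multivariateGaussian hS i j)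

end GaussianFunctionals

section GaussianDivergence

section ChernoffExponent

variable {ι : Type*} [Fintype ι] [DecidableEq ι] {S Ψ : Matrix ι ι ℝ} {α : ℝ}

/-- The Chernoff exponent `-log ∫ p ^ α q ^ (1 - α)` of the Gaussians `p` and `q` with means `μ`,
`ν` and covariances `S`, `Ψ`, in closed form: a Jensen gap for the covariances plus a quadratic
penalty for the distance of the means. -/
noncomputable def chernoffExponent (α : ℝ) (μ : EuclideanSpace ℝ ι) (S : Matrix ι ι ℝ)
    (ν : EuclideanSpace ℝ ι) (Ψ : Matrix ι ι ℝ) : ℝ :=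
  1 / 2 * (logDetGap α S Ψ +
    α * (1 - α) * ((ν - μ).ofLp ⬝ᵥ (mixCov α S Ψ)⁻¹ *ᵥ (ν - μ).ofLp))

theorem chernoffExponent_same_mean (α : ℝ) (μ : EuclideanSpace ℝ ι) (S Ψ : Matrix ι ι ℝ) :
    chernoffExponent α μ S μ Ψ = 1 / 2 * logDetGap α S Ψ := by
  simp [chernoffExponent]

theorem chernoffExponent_same_mean_lt (hS : S.PosDef) (hΨ : Ψ.PosDef) (hα : α ∈ Ioo (0 : ℝ) 1)
    {μ ν : EuclideanSpace ℝ ι} (hνμ : ν ≠ μ) :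
    chernoffExponent α μ S μ Ψ < chernoffExponent α μ S ν Ψ := by
  have hne : (ν - μ).ofLp ≠ 0 := fun h => hνμ (sub_eq_zero.1 (WithLp.ofLp_injective 2 h))
  have hpos := (posDef_mixCov hS hΨ (Ioo_subset_Icc_self hα)).inv.dotProduct_mulVec_pos hne
  rw [star_trivial] at hpos
  rw [chernoffExponent_same_mean, chernoffExponent]
  gcongr
  exact lt_add_of_pos_right _ (mul_pos (mul_pos hα.1 (sub_pos.2 hα.2)) hpos)

theorem smul_inv_add_smul_inv_eq (hS : IsUnit S.det) (hΨ : IsUnit Ψ.det) (α : ℝ) :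
    α • S⁻¹ + (1 - α) • Ψ⁻¹ = S⁻¹ * mixCov α S Ψ * Ψ⁻¹ := by
  rw [mixCov, Matrix.mul_add, Matrix.add_mul, Matrix.mul_smul, Matrix.mul_smul, Matrix.smul_mul,
    Matrix.smul_mul, mul_nonsing_inv_cancel_right _ _ hΨ, nonsing_inv_mul _ hS, Matrix.one_mul]

theorem log_det_inv_smul_inv_add_smul_inv (hS : S.PosDef) (hΨ : Ψ.PosDef)
    (hα : α ∈ Icc (0 : ℝ) 1) :
    Real.log (α • S⁻¹ + (1 - α) • Ψ⁻¹)⁻¹.det =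
      Real.log S.det + Real.log Ψ.det - Real.log (mixCov α S Ψ).det := by
  have hSdet := hS.det_pos.ne'
  have hΨdet := hΨ.det_pos.ne'
  have hmix := (posDef_mixCov hS hΨ hα).det_pos.ne'
  rw [smul_inv_add_smul_inv_eq hSdet.isUnit hΨdet.isUnit, det_nonsing_inv, Ring.inverse_eq_inv',
    det_mul, det_mul, det_nonsing_inv, det_nonsing_inv, Ring.inverse_eq_inv', Real.log_inv,
    Real.log_mul (mul_ne_zero (inv_ne_zero hSdet) hmix) (inv_ne_zero hΨdet),
    Real.log_mul (inv_ne_zero hSdet) hmix, Real.log_inv, Real.log_inv]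
  ring

theorem complete_square_smul_inv_add_smul_inv (hS : S.PosDef) (hΨ : Ψ.PosDef)
    (hα : α ∈ Icc (0 : ℝ) 1) (μ ν : ι → ℝ) :
    ∃ w : ι → ℝ, ∀ z, α * ((z - μ) ⬝ᵥ S⁻¹ *ᵥ (z - μ)) + (1 - α) * ((z - ν) ⬝ᵥ Ψ⁻¹ *ᵥ (z - ν)) =
      (z - w) ⬝ᵥ (α • S⁻¹ + (1 - α) • Ψ⁻¹) *ᵥ (z - w) +
        α * (1 - α) * ((ν - μ) ⬝ᵥ (mixCov α S Ψ)⁻¹ *ᵥ (ν - μ)) := by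
  obtain ⟨m, hm⟩ : ∃ m, m = (mixCov α S Ψ)⁻¹ *ᵥ (ν - μ) := ⟨_, rfl⟩
  have hmean : ν - μ = α • Ψ *ᵥ m + (1 - α) • S *ᵥ m := by
    rw [← smul_mulVec, ← smul_mulVec, ← add_mulVec, ← mixCov, hm, mulVec_mulVec,
      mul_nonsing_inv _ (posDef_mixCov hS hΨ hα).det_pos.ne'.isUnit, one_mulVec]
  refine ⟨μ + (1 - α) • S *ᵥ m, fun z => ?_⟩
  obtain ⟨v, hv⟩ : ∃ v, v = z - (μ + (1 - α) • S *ᵥ m) := ⟨_, rfl⟩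
  have hzμ : z - μ = v + S⁻¹⁻¹ *ᵥ ((1 - α) • m) := by
    rw [nonsing_inv_nonsing_inv _ hS.det_pos.ne'.isUnit, mulVec_smul, hv]
    abel
  have hzν : z - ν = v + Ψ⁻¹⁻¹ *ᵥ (-α • m) := by
    rw [nonsing_inv_nonsing_inv _ hΨ.det_pos.ne'.isUnit, mulVec_smul, hv, neg_smul,
      ← sub_sub_sub_cancel_right z ν μ, hmean]
    abel
  rw [← hm, ← hv, hzμ, hzν, dotProduct_mulVec_add_inv_mulVec (isSymm_of_posDef hS.inv)
      hS.inv.det_pos.ne'.isUnit, dotProduct_mulVec_add_inv_mulVec (isSymm_of_posDef hΨ.inv)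
      hΨ.inv.det_pos.ne'.isUnit, nonsing_inv_nonsing_inv _ hS.det_pos.ne'.isUnit,
    nonsing_inv_nonsing_inv _ hΨ.det_pos.ne'.isUnit, hmean]
  simp only [add_mulVec, smul_mulVec, mulVec_smul, add_dotProduct, dotProduct_add,
    smul_dotProduct, dotProduct_smul, smul_eq_mul, dotProduct_comm (Ψ *ᵥ m) m,
    dotProduct_comm (S *ᵥ m) m]
  ring

theorem exists_smul_gaussianLogDensity_add_eq (hS : S.PosDef) (hΨ : Ψ.PosDef)
    (hα : α ∈ Icc (0 : ℝ) 1) (μ ν : EuclideanSpace ℝ ι) :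
    ∃ w : EuclideanSpace ℝ ι, ∀ z,
      α * gaussianLogDensity μ S z + (1 - α) * gaussianLogDensity ν Ψ z =
        -chernoffExponent α μ S ν Ψ + gaussianLogDensity w (α • S⁻¹ + (1 - α) • Ψ⁻¹)⁻¹ z := by
  have hprec : (α • S⁻¹ + (1 - α) • Ψ⁻¹).PosDef :=
    posDef_smul_add_smul hS.inv hΨ.inv hα.1 (sub_nonneg.2 hα.2) (add_sub_cancel _ _)
  obtain ⟨w, hw⟩ := complete_square_smul_inv_add_smul_inv hS hΨ hα μ.ofLp ν.ofLp
  refine ⟨WithLp.toLp 2 w, fun z => ?_⟩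
  simp only [gaussianLogDensity, chernoffExponent, logDetGap, WithLp.ofLp_sub,
    log_det_inv_smul_inv_add_smul_inv hS hΨ hα,
    nonsing_inv_nonsing_inv _ hprec.det_pos.ne'.isUnit]
  linear_combination (-1 / 2) * hw z.ofLp

theorem IsStationary.chernoffExponent_lt {d e : ι → ℝ} (hS : S.PosDef) (hα : α ∈ Ioo (0 : ℝ) 1)
    (hd : IsStationary α S d) (he : ∀ i, 0 < e i) {μ ν : EuclideanSpace ℝ ι}
    (hne : ν ≠ μ ∨ e ≠ d) :
    chernoffExponent α μ S μ (diagonal d) < chernoffExponent α μ S ν (diagonal e) := by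
  have hgap : e ≠ d →
      chernoffExponent α μ S μ (diagonal d) < chernoffExponent α μ S μ (diagonal e) := fun hed => by
    rw [chernoffExponent_same_mean, chernoffExponent_same_mean]
    exact mul_lt_mul_of_pos_left (hd.logDetGap_lt hS hα he hed) one_half_pos
  rcases eq_or_ne ν μ with rfl | hν
  · exact hgap (hne.resolve_left fun h => h rfl)
  · have hmean := chernoffExponent_same_mean_lt hS (PosDef.diagonal he) hα hν
    rcases eq_or_ne e d with rfl | hed
    exacts [hmean, (hgap hed).trans hmean]

end ChernoffExponent

variable {n : ℕ} {S Ψ : Matrix (Fin n) (Fin n) ℝ} {α : ℝ}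

theorem renyiDiv_multivariateGaussian (hS : S.PosDef) (hΨ : Ψ.PosDef) (hα : α ∈ Icc (0 : ℝ) 1)
    (μ ν : EuclideanSpace ℝ (Fin n)) :
    renyiDiv α (multivariateGaussian μ S) (multivariateGaussian ν Ψ) =
      1 / (α * (α - 1)) * (Real.exp (-chernoffExponent α μ S ν Ψ) - 1) := by
  obtain ⟨w, hw⟩ := exists_smul_gaussianLogDensity_add_eq hS hΨ hα μ ν
  have hcov : (α • S⁻¹ + (1 - α) • Ψ⁻¹)⁻¹.PosDef :=
    (posDef_smul_add_smul hS.inv hΨ.inv hα.1 (sub_nonneg.2 hα.2) (add_sub_cancel _ _)).inv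
  have hintegrand : (fun z => (density (multivariateGaussian μ S) z ^ α /
      density (multivariateGaussian ν Ψ) z ^ α - 1) * density (multivariateGaussian ν Ψ) z)
      =ᵐ[volume] fun z => Real.exp (-chernoffExponent α μ S ν Ψ) *
        Real.exp (gaussianLogDensity w (α • S⁻¹ + (1 - α) • Ψ⁻¹)⁻¹ z) -
        Real.exp (gaussianLogDensity ν Ψ z) := by
    filter_upwards [density_multivariateGaussian hS μ, density_multivariateGaussian hΨ ν]
      with z hzμ hzν
    rw [hzμ, hzν, ← Real.exp_mul, ← Real.exp_mul, ← Real.exp_sub, sub_mul, one_mul,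
      ← Real.exp_add, ← Real.exp_add, ← hw z]
    ring_nf
  rw [renyiDiv, integral_congr_ae hintegrand, integral_sub
    ((integrable_exp_gaussianLogDensity hcov w).const_mul _)
    (integrable_exp_gaussianLogDensity hΨ ν), integral_const_mul,
    integral_exp_gaussianLogDensity hcov, integral_exp_gaussianLogDensity hΨ, mul_one]

theorem mem_factorizedGaussians_iff (q : Measure (EuclideanSpace ℝ (Fin n))) :
    q ∈ factorizedGaussians n ↔ ∃ (ν : EuclideanSpace ℝ (Fin n)) (d : Fin n → ℝ),
      (∀ i, 0 < d i) ∧ q = multivariateGaussian ν (diagonal d) := by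
  constructor
  · rintro ⟨ν, Ψ, hΨ, hdiag, rfl⟩
    exact ⟨ν, diag Ψ, fun i => hΨ.diag_pos, by rw [hdiag.diagonal_diag]⟩
  · rintro ⟨ν, d, hd, rfl⟩
    exact ⟨ν, diagonal d, PosDef.diagonal hd, isDiag_diagonal d, rfl⟩

theorem IsStationary.renyiDiv_lt {d : Fin n → ℝ} (hS : S.PosDef) (hα : α ∈ Ioo (0 : ℝ) 1)
    (hd : IsStationary α S d) (μ : EuclideanSpace ℝ (Fin n))
    {q : Measure (EuclideanSpace ℝ (Fin n))} (hq : q ∈ factorizedGaussians n)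
    (hne : q ≠ multivariateGaussian μ (diagonal d)) :
    renyiDiv α (multivariateGaussian μ S) (multivariateGaussian μ (diagonal d)) <
      renyiDiv α (multivariateGaussian μ S) q := by
  obtain ⟨ν, e, he, rfl⟩ := (mem_factorizedGaussians_iff q).1 hq
  have hparam : ν ≠ μ ∨ e ≠ d := by
    by_contra! h
    exact hne (by rw [h.1, h.2])
  have hcoeff : 1 / (α * (α - 1)) < 0 :=
    one_div_neg.2 (mul_neg_of_pos_of_neg hα.1 (sub_neg.2 hα.2))
  have hαI := Ioo_subset_Icc_self hα
  rw [renyiDiv_multivariateGaussian hS hd.posDef_diagonal hαI,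
    renyiDiv_multivariateGaussian hS (PosDef.diagonal he) hαI, mul_lt_mul_left_of_neg hcoeff,
    sub_lt_sub_iff_right, Real.exp_lt_exp, neg_lt_neg_iff]
  exact hd.chernoffExponent_lt hS hα he hparam

theorem IsStationary.isRenyiMinimizer_iff {d : Fin n → ℝ} (hS : S.PosDef)
    (hα : α ∈ Ioo (0 : ℝ) 1) (hd : IsStationary α S d) (μ : EuclideanSpace ℝ (Fin n))
    (q : Measure (EuclideanSpace ℝ (Fin n))) :
    IsRenyiMinimizer α (multivariateGaussian μ S) q ↔ q = multivariateGaussian μ (diagonal d) := by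
  have hmem : multivariateGaussian μ (diagonal d) ∈ factorizedGaussians n :=
    (mem_factorizedGaussians_iff _).2 ⟨μ, d, hd.1, rfl⟩
  constructor
  · rintro ⟨hq, hmin⟩
    by_contra hne
    exact (isMinOn_iff.1 hmin _ hmem).not_gt (hd.renyiDiv_lt hS hα μ hq hne)
  · rintro rfl
    refine ⟨hmem, isMinOn_iff.2 fun q' hq' => ?_⟩
    rcases eq_or_ne q' (multivariateGaussian μ (diagonal d)) with rfl | hne
    exacts [le_rfl, (hd.renyiDiv_lt hS hα μ hq' hne).le]

theorem existsUnique_isRenyiMinimizer (hS : S.PosDef) (hα : α ∈ Ioo (0 : ℝ) 1)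
    (μ : EuclideanSpace ℝ (Fin n)) :
    ∃! q, IsRenyiMinimizer α (multivariateGaussian μ S) q := by
  obtain ⟨d, hd⟩ := exists_isStationary hS (Ioo_subset_Icc_self hα)
  simp only [hd.isRenyiMinimizer_iff hS hα, existsUnique_eq]

theorem exists_isRenyiMinimizer_entropy_eq_iff (hS : S.PosDef) (hα : α ∈ Ioo (0 : ℝ) 1)
    (μ : EuclideanSpace ℝ (Fin n)) :
    (∃ q, IsRenyiMinimizer α (multivariateGaussian μ S) q ∧
      entropy q = entropy (multivariateGaussian μ S)) ↔
      ∃ d, IsStationary α S d ∧ ∏ i, d i = S.det := by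
  have hentropy : ∀ {d}, IsStationary α S d →
      (entropy (multivariateGaussian μ (diagonal d)) = entropy (multivariateGaussian μ S) ↔
        ∏ i, d i = S.det) := fun hd => by
    rw [entropy_multivariateGaussian_eq_iff hS hd.posDef_diagonal, det_diagonal]
  constructor
  · rintro ⟨q, hq, hent⟩
    obtain ⟨d, hd⟩ := exists_isStationary hS (Ioo_subset_Icc_self hα)
    obtain rfl := (hd.isRenyiMinimizer_iff hS hα μ q).1 hq
    exact ⟨d, hd, (hentropy hd).1 hent⟩
  · rintro ⟨d, hd, hdet⟩
    exact ⟨_, (hd.isRenyiMinimizer_iff hS hα μ _).2 rfl, (hentropy hd).2 hdet⟩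

end GaussianDivergence

end FactorizedVI

theorem mainTheorem6 (n : ℕ) (μ : EuclideanSpace ℝ (Fin n)) (S : Matrix (Fin n) (Fin n) ℝ)
    (hS : S.PosDef) (hdiag : ¬ S.IsDiag) :
    -- for each order the minimizing factorized Gaussian exists and is unique
    (∀ α ∈ Ioo (0 : ℝ) 1,
      ∃! q, FactorizedVI.IsRenyiMinimizer α (multivariateGaussian μ S) q) ∧
    -- exactly one order matches the entropy
    (∃! α : ℝ, α ∈ Ioo (0 : ℝ) 1 ∧
      ∃ q, FactorizedVI.IsRenyiMinimizer α (multivariateGaussian μ S) q ∧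
        FactorizedVI.entropy q = FactorizedVI.entropy (multivariateGaussian μ S)) ∧
    -- matching the entropy is the same as matching the generalized variance
    (∀ q ∈ FactorizedVI.factorizedGaussians n,
      FactorizedVI.entropy q = FactorizedVI.entropy (multivariateGaussian μ S) ↔
        FactorizedVI.generalizedVariance q =
          FactorizedVI.generalizedVariance (multivariateGaussian μ S)) := by
  refine ⟨fun α hα => FactorizedVI.existsUnique_isRenyiMinimizer hS hα μ, ?_, ?_⟩
  · refine (existsUnique_congr fun α => and_congr_right fun hα => ?_).2
      (FactorizedVI.existsUnique_isStationary_prod_eq_det hS hdiag)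
    exact FactorizedVI.exists_isRenyiMinimizer_entropy_eq_iff hS hα μ
  · rintro q ⟨ν, Ψ, hΨ, -, rfl⟩
    rw [FactorizedVI.entropy_multivariateGaussian_eq_iff hS hΨ,
      FactorizedVI.generalizedVariance_multivariateGaussian hΨ.posSemidef,
      FactorizedVI.generalizedVariance_multivariateGaussian hS.posSemidef]
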